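/- Let $k$ be a field. For a coalgebra $C$ over $k$ with comultiplication $\Delta$, a right coideal of $C$ is a subspace $N\subseteq C$ with $\Delta(N)\subseteq N\otimes C$, and a subcoalgebra is a subspace $E\subseteq C$ with $\Delta(E)\subseteq E\otimes E$. The coalgebra $C$ is called a chain coalgebra if any two of its right coideals are comparable with respect to inclusion. Let $C_0$ be the sum of all simple (i.e. minimal non-zero) right coideals of $C$, that is, the socle of $C$ as a right $C$-comodule; it is a subcoalgebra of $C$, so that $C_0^*=\mathrm{Hom}_k(C_0,k)$ is a $k$-algebra under the convolution product. For a finite-dimensional division algebra $D$ over $k$, a chain coalgebra $C$ is said to be of type $D$ if $D\simeq C_0^*$ as $k$-algebras. For a $k$-algebra $A$, the finite dual $A^\circ$ is the coalgebra of all $k$-linear maps $f:A\to k$ that vanish on some two-sided ideal of finite codimension in $A$, with the comultiplication dual to the multiplication of $A$ (if $\Delta(f)=\sum_i f_i\otimes g_i$ then $f(ab)=\sum_i f_i(a)g_i(b)$ for all $a,b\in A$) and the counit $f\mapsto f(1)$. Let $D$ be a finite-dimensional central division algebra over $k$ (i.e. the center of $D$ is $k$), and let $D[[x]]$ be the algebra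 of formal power series in $x$ with coefficients in $D$, where $x$ commutes with the elements of $D$. Then every chain coalgebra over $k$ of type $D$ is isomorphic, as a coalgebra, to a subcoalgebra of $D[[x]]^\circ$. -/

import Mathlib

open scoped TensorProduct

noncomputable section

namespace ChainCoalg

universe u v w

/-! ### Linear algebra of tensor products over a field -/

section LinAlg

variable {k : Type u} [Field k] {V : Type v} [AddCommGroup V] [Module k V]
  {W : Type w} [AddCommGroup W] [Module k W]

/-- A family of functionals separating the points of `V` separates the points of `V ⊗ W`. -/
theorem eq_zero_of_rTensor {ι : Type*} (F : ι → V →ₗ[k] k)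
    (hF : ∀ v, (∀ i, F i v = 0) → v = 0) (t : V ⊗[k] W)
    (ht : ∀ i, (F i).rTensor W t = 0) : t = 0 := by
  classical
  let b := Module.Basis.ofVectorSpace k W
  apply (TensorProduct.equivFinsuppOfBasisRight (M := V) b).injective
  rw [map_zero]
  ext j
  apply hF
  intro i
  have key : ∀ s : V ⊗[k] W, F i (TensorProduct.equivFinsuppOfBasisRight (M := V) b s j) =
      b.coord j (TensorProduct.lid k W ((F i).rTensor W s)) := by
    intro s
    induction s with
    | zero => simp
    | tmul x y => simp [mul_comm]
    | add x y hx hy => simp only [map_add, Finsupp.add_apply, hx, hy]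
  rw [key, ht]
  simp

theorem eq_zero_of_lTensor {ι : Type*} (F : ι → W →ₗ[k] k)
    (hF : ∀ v, (∀ i, F i v = 0) → v = 0) (t : V ⊗[k] W)
    (ht : ∀ i, (F i).lTensor V t = 0) : t = 0 := by
  apply (TensorProduct.comm k V W).injective
  rw [map_zero]
  refine eq_zero_of_rTensor F hF _ fun i => ?_
  have key : ∀ s : V ⊗[k] W, (F i).rTensor V (TensorProduct.comm k V W s) =
      TensorProduct.comm k V k ((F i).lTensor V s) := by
    intro s
    induction s with
    | zero => simp
    | tmul x y => simp
    | add x y hx hy => simp only [map_add, hx, hy]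
  rw [key, ht, map_zero]

theorem eq_of_all_dual (x : V) (hx : ∀ f : V →ₗ[k] k, f x = 0) : x = 0 :=
  (Module.forall_dual_apply_eq_zero_iff k x).1 hx

theorem exists_projection (N : Submodule k V) :
    ∃ p : V →ₗ[k] N, p ∘ₗ N.subtype = LinearMap.id :=
  N.subtype.exists_leftInverse_of_injective N.ker_subtype

end LinAlg

/-! ### Subcoalgebras -/

/-- A subcoalgebra of `C`: a subspace `E` with `Δ(E) ⊆ E ⊗ E`. -/
structure Subcoalgebra (k : Type u) [Field k] (C : Type v) [AddCommGroup C] [Module k C]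
    [Coalgebra k C] where
  carrier : Submodule k C
  comul_mem : ∀ x ∈ carrier, Coalgebra.comul (R := k) x ∈
    LinearMap.range (TensorProduct.map carrier.subtype carrier.subtype)

namespace Subcoalgebra

variable {k : Type u} [Field k] {C : Type v} [AddCommGroup C] [Module k C] [Coalgebra k C]

instance : CoeSort (Subcoalgebra k C) (Type v) := ⟨fun E => ↥E.carrier⟩

variable (E : Subcoalgebra k C)

theorem map_subtype_injective :
    Function.Injective (TensorProduct.map E.carrier.subtype E.carrier.subtype) :=
  TensorProduct.map_injective_of_flat_flat _ _ E.carrier.injective_subtype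
    E.carrier.injective_subtype

/-- The restriction of `Δ` to `E`, as a map `E → E ⊗ E`. -/
def comul : E →ₗ[k] E ⊗[k] E :=
  LinearMap.codRestrictOfInjective (Coalgebra.comul ∘ₗ E.carrier.subtype)
    (TensorProduct.map E.carrier.subtype E.carrier.subtype) E.map_subtype_injective
    (fun x => E.comul_mem x x.2)

theorem map_comul (x : E) : TensorProduct.map E.carrier.subtype E.carrier.subtype (E.comul x) =
    Coalgebra.comul (R := k) (x : C) :=
  LinearMap.codRestrictOfInjective_comp_apply _ _ _ _ x

/-- The coalgebra structure of a subcoalgebra is the restriction of that of `C`. -/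
instance : Coalgebra k E.carrier where
  comul := E.comul
  counit := Coalgebra.counit ∘ₗ E.carrier.subtype
  coassoc := by
    ext x
    apply TensorProduct.map_injective_of_flat_flat E.carrier.subtype
      (TensorProduct.map E.carrier.subtype E.carrier.subtype)
      E.carrier.injective_subtype E.map_subtype_injective
    have h1 : ∀ t : E ⊗[k] E,
        TensorProduct.map E.carrier.subtype (TensorProduct.map E.carrier.subtype E.carrier.subtype)
          (TensorProduct.assoc k E E E (E.comul.rTensor E t)) =
        TensorProduct.assoc k C C C ((Coalgebra.comul (R := k)).rTensor C
          (TensorProduct.map E.carrier.subtype E.carrier.subtype t)) := by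
      intro t
      induction t with
      | zero => simp
      | add x y hx hy => simp only [map_add, hx, hy]
      | tmul x y =>
        simp only [LinearMap.rTensor_tmul, TensorProduct.map_tmul, Submodule.subtype_apply]
        rw [← E.map_comul]
        generalize E.comul x = s
        induction s with
        | zero => simp
        | tmul a b => simp
        | add a b ha hb => simp only [map_add, TensorProduct.add_tmul, ha, hb]
    have h2 : ∀ t : E ⊗[k] E,
        TensorProduct.map E.carrier.subtype (TensorProduct.map E.carrier.subtype E.carrier.subtype)
          (E.comul.lTensor E t) =
        (Coalgebra.comul (R := k)).lTensor C
          (TensorProduct.map E.carrier.subtype E.carrier.subtype t) := by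
      intro t
      induction t with
      | zero => simp
      | add x y hx hy => simp only [map_add, hx, hy]
      | tmul x y =>
        simp only [LinearMap.lTensor_tmul, TensorProduct.map_tmul, Submodule.subtype_apply]
        rw [← E.map_comul]
    simp only [LinearMap.comp_apply, LinearEquiv.coe_coe]
    rw [h1, h2, E.map_comul, Coalgebra.coassoc_apply]
  rTensor_counit_comp_comul := by
    ext x
    have h : ∀ t : E ⊗[k] E, E.carrier.subtype.lTensor k
        ((Coalgebra.counit ∘ₗ E.carrier.subtype).rTensor E t) =
        (Coalgebra.counit (R := k)).rTensor C
          (TensorProduct.map E.carrier.subtype E.carrier.subtype t) := by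
      intro t
      induction t with
      | zero => simp
      | tmul a b => simp
      | add a b ha hb => simp only [map_add, ha, hb]
    apply Module.Flat.lTensor_preserves_injective_linearMap (M := k) E.carrier.subtype
      E.carrier.injective_subtype
    simp only [LinearMap.comp_apply]
    rw [h, E.map_comul, Coalgebra.rTensor_counit_comul]
    simp
  lTensor_counit_comp_comul := by
    ext x
    have h : ∀ t : E ⊗[k] E, E.carrier.subtype.rTensor k
        ((Coalgebra.counit ∘ₗ E.carrier.subtype).lTensor E t) =
        (Coalgebra.counit (R := k)).lTensor C
          (TensorProduct.map E.carrier.subtype E.carrier.subtype t) := by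
      intro t
      induction t with
      | zero => simp
      | tmul a b => simp
      | add a b ha hb => simp only [map_add, ha, hb]
    apply Module.Flat.rTensor_preserves_injective_linearMap (M := k) E.carrier.subtype
      E.carrier.injective_subtype
    simp only [LinearMap.comp_apply]
    rw [h, E.map_comul, Coalgebra.lTensor_counit_comul]
    simp

end Subcoalgebra

/-! ### Right coideals, chain coalgebras, and the coradical -/

section Coideals

variable {k : Type u} [Field k] {C : Type v} [AddCommGroup C] [Module k C] [Coalgebra k C]

/-- A right coideal of `C`, that is, a right subcomodule of `C`: a subspace `N` with
`Δ(N) ⊆ N ⊗ C`. -/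
def IsRightCoideal (N : Submodule k C) : Prop :=
  ∀ x ∈ N, Coalgebra.comul (R := k) x ∈ LinearMap.range (N.subtype.rTensor C)

/-- A simple right coideal: nonzero, and with no right coideals in it but zero and itself. -/
def IsSimpleRightCoideal (N : Submodule k C) : Prop :=
  IsRightCoideal N ∧ N ≠ ⊥ ∧ ∀ M : Submodule k C, IsRightCoideal M → M ≤ N → M = ⊥ ∨ M = N

/-- The left action `f ⇀ c = (id ⊗ f)(Δ c)` of the dual algebra `C^*` on `C`. -/
def leftHit (f : C →ₗ[k] k) : C →ₗ[k] C :=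
  (TensorProduct.rid k C).toLinearMap ∘ₗ f.lTensor C ∘ₗ Coalgebra.comul

/-- The right action `c ↼ g = (g ⊗ id)(Δ c)` of the dual algebra `C^*` on `C`. -/
def rightHit (g : C →ₗ[k] k) : C →ₗ[k] C :=
  (TensorProduct.lid k C).toLinearMap ∘ₗ g.rTensor C ∘ₗ Coalgebra.comul

theorem leftHit_rightHit (f g : C →ₗ[k] k) (c : C) :
    leftHit f (rightHit g c) = rightHit g (leftHit f c) := by
  have h1 : ∀ t : C ⊗[k] C, leftHit f (TensorProduct.lid k C (g.rTensor C t)) =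
      TensorProduct.rid k C (TensorProduct.lid k (C ⊗[k] k) (g.rTensor _ ((f.lTensor C).lTensor C
        ((Coalgebra.comul (R := k)).lTensor C t)))) := by
    intro t
    induction t with
    | zero => simp
    | add a b ha hb => simp only [map_add, ha, hb]
    | tmul a b => simp [leftHit]
  have h2 : ∀ t : C ⊗[k] C, rightHit g (TensorProduct.rid k C (f.lTensor C t)) =
      TensorProduct.rid k C (TensorProduct.lid k (C ⊗[k] k) (g.rTensor _ ((f.lTensor C).lTensor C
        (TensorProduct.assoc k C C C ((Coalgebra.comul (R := k)).rTensor C t))))) := by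
    intro t
    induction t with
    | zero => simp
    | add a b ha hb => simp only [map_add, ha, hb]
    | tmul a b =>
      simp only [rightHit, LinearMap.comp_apply, LinearMap.lTensor_tmul, TensorProduct.rid_tmul,
        map_smul, LinearMap.rTensor_tmul, LinearEquiv.coe_coe]
      generalize (Coalgebra.comul (R := k) a) = s
      induction s with
      | zero => simp
      | tmul x y => simp [smul_smul, mul_comm]
      | add x y hx hy => simp only [map_add, TensorProduct.add_tmul, smul_add, hx, hy]
  have e1 : leftHit f (rightHit g c) = _ := h1 (Coalgebra.comul c)
  have e2 : rightHit g (leftHit f c) = _ := h2 (Coalgebra.comul c)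
  rw [e1, e2, Coalgebra.coassoc_apply]

/-- Right coideals are the same as left `C^*`-submodules of `C`. -/
theorem isRightCoideal_iff (N : Submodule k C) :
    IsRightCoideal N ↔ ∀ f : C →ₗ[k] k, ∀ x ∈ N, leftHit f x ∈ N := by
  constructor
  · intro h f x hx
    obtain ⟨t, ht⟩ := h x hx
    have : leftHit f x = N.subtype (TensorProduct.rid k N (f.lTensor N t)) := by
      simp only [leftHit, LinearMap.comp_apply, ← ht, LinearEquiv.coe_coe]
      generalize t = s
      induction s with
      | zero => simp
      | tmul a b => simp
      | add a b ha hb => simp only [map_add, ha, hb]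
    rw [this]
    exact Subtype.property _
  · intro h x hx
    obtain ⟨p, hp⟩ := exists_projection N
    refine ⟨p.rTensor C (Coalgebra.comul x), ?_⟩
    rw [← sub_eq_zero]
    refine eq_zero_of_lTensor (fun f : C →ₗ[k] k => f) eq_of_all_dual _ fun f => ?_
    apply (TensorProduct.rid k C).injective
    have key : ∀ t : C ⊗[k] C, TensorProduct.rid k C (f.lTensor C
        (N.subtype.rTensor C (p.rTensor C t))) = p (TensorProduct.rid k C (f.lTensor C t)) := by
      intro t
      induction t with
      | zero => simp
      | tmul a b => simp
      | add a b ha hb => simp only [map_add, ha, hb, Submodule.coe_add]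
    rw [map_sub, map_sub, map_zero, key, sub_eq_zero]
    have := LinearMap.congr_fun hp ⟨_, h f x hx⟩
    exact congrArg Subtype.val this

theorem exists_eq_of_rightHit (N : Submodule k C)
    (h : ∀ g : C →ₗ[k] k, ∀ x ∈ N, rightHit g x ∈ N) (p : C →ₗ[k] N)
    (hp : p ∘ₗ N.subtype = LinearMap.id) (x : C) (hx : x ∈ N) :
    N.subtype.lTensor C (p.lTensor C (Coalgebra.comul (R := k) x)) = Coalgebra.comul (R := k) x := by
  rw [← sub_eq_zero]
  refine eq_zero_of_rTensor (fun f : C →ₗ[k] k => f) eq_of_all_dual _ fun f => ?_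
  apply (TensorProduct.lid k C).injective
  have key : ∀ t : C ⊗[k] C, TensorProduct.lid k C (f.rTensor C
      (N.subtype.lTensor C (p.lTensor C t))) = p (TensorProduct.lid k C (f.rTensor C t)) := by
    intro t
    induction t with
    | zero => simp
    | tmul a b => simp
    | add a b ha hb => simp only [map_add, ha, hb, Submodule.coe_add]
  rw [map_sub, map_sub, map_zero, key, sub_eq_zero]
  exact congrArg Subtype.val (LinearMap.congr_fun hp ⟨_, h f x hx⟩)

/-- A subspace that is stable under both actions of `C^*` is a subcoalgebra. -/
theorem comul_mem_of_hit (N : Submodule k C) (hN : IsRightCoideal N)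
    (h : ∀ g : C →ₗ[k] k, ∀ x ∈ N, rightHit g x ∈ N) (x : C) (hx : x ∈ N) :
    Coalgebra.comul (R := k) x ∈ LinearMap.range (TensorProduct.map N.subtype N.subtype) := by
  obtain ⟨p, hp⟩ := exists_projection N
  obtain ⟨t, ht⟩ := hN x hx
  refine ⟨p.lTensor N t, ?_⟩
  have h1 := exists_eq_of_rightHit N h p hp x hx
  rw [← ht] at h1 ⊢
  rw [← h1]
  generalize t = s
  induction s with
  | zero => simp
  | tmul a b => simp
  | add a b ha hb => simp only [map_add, ha, hb]

theorem isRightCoideal_map_rightHit (g : C →ₗ[k] k) (N : Submodule k C) (hN : IsRightCoideal N) :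
    IsRightCoideal (N.map (rightHit g)) := by
  rw [isRightCoideal_iff] at hN ⊢
  rintro f _ ⟨x, hx, rfl⟩
  rw [leftHit_rightHit]
  exact ⟨_, hN f x hx, rfl⟩

theorem isSimpleRightCoideal_map_rightHit (g : C →ₗ[k] k) (N : Submodule k C)
    (hN : IsSimpleRightCoideal N) (h0 : N.map (rightHit g) ≠ ⊥) :
    IsSimpleRightCoideal (N.map (rightHit g)) := by
  refine ⟨isRightCoideal_map_rightHit g N hN.1, h0, fun M hM hMN => ?_⟩
  have h1 : IsRightCoideal (N ⊓ M.comap (rightHit g)) := by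
    have hN' := (isRightCoideal_iff N).1 hN.1
    rw [isRightCoideal_iff] at hM ⊢
    rintro f x ⟨hx, hxM⟩
    refine ⟨hN' f x hx, ?_⟩
    change rightHit g (leftHit f x) ∈ M
    rw [← leftHit_rightHit]
    exact hM f _ hxM
  rcases hN.2.2 _ h1 inf_le_left with h | h
  · left
    rw [eq_bot_iff]
    intro y hy
    obtain ⟨x, hx, rfl⟩ := hMN hy
    have : x ∈ N ⊓ M.comap (rightHit g) := ⟨hx, hy⟩
    rw [h, Submodule.mem_bot] at this
    simp [this]
  · right
    refine le_antisymm hMN ?_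
    rw [Submodule.map_le_iff_le_comap]
    exact inf_eq_left.1 h

variable (k C)

/-- The socle of `C` as a right comodule (equivalently, as a left `C^*`-module): the sum of the
simple right coideals. -/
def socle : Submodule k C := sSup {N | IsSimpleRightCoideal N}

theorem isRightCoideal_socle : IsRightCoideal (socle k C) := by
  rw [isRightCoideal_iff]
  intro f
  change socle k C ≤ (socle k C).comap (leftHit f)
  refine sSup_le fun N hN x hx => ?_
  exact (le_sSup hN : N ≤ socle k C) ((isRightCoideal_iff N).1 hN.1 f x hx)

theorem rightHit_socle (g : C →ₗ[k] k) : ∀ x ∈ socle k C, rightHit g x ∈ socle k C := by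
  change socle k C ≤ (socle k C).comap (rightHit g)
  refine sSup_le fun N hN => ?_
  rw [← Submodule.map_le_iff_le_comap]
  by_cases h0 : N.map (rightHit g) = ⊥
  · rw [h0]; exact bot_le
  · exact le_sSup (isSimpleRightCoideal_map_rightHit g N hN h0)

/-- The coradical `C₀` of `C`: the socle, with its structure of a subcoalgebra. -/
def coradical : Subcoalgebra k C where
  carrier := socle k C
  comul_mem := comul_mem_of_hit _ (isRightCoideal_socle k C) (rightHit_socle k C)

/-- A chain coalgebra: any two right coideals are comparable, so that the lattice of right coideals
is a chain. -/
def IsChainCoalgebra : Prop :=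
  ∀ M N : Submodule k C, IsRightCoideal M → IsRightCoideal N → M ≤ N ∨ N ≤ M

/-- A chain coalgebra of type `D`: a chain coalgebra such that `D ≃ (C₀)^*` as `k`-algebras, where
`(C₀)^*` has the convolution product. -/
def IsChainCoalgebraOfType (D : Type w) [DivisionRing D] [Algebra k D] : Prop :=
  IsChainCoalgebra k C ∧ Nonempty (D ≃ₐ[k] WithConv (coradical k C →ₗ[k] k))

end Coideals

/-! ### The finite dual of an algebra -/

section FiniteDual

variable (k : Type u) [Field k] (A : Type v) [Ring A] [Algebra k A]

/-- The subspace of the functionals on `A` that vanish on some two-sided ideal of finite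
codimension. -/
def finiteDualSubmodule : Submodule k (A →ₗ[k] k) where
  carrier := {f | ∃ I : Ideal A, I.IsTwoSided ∧ FiniteDimensional k (A ⧸ I) ∧ ∀ a ∈ I, f a = 0}
  zero_mem' := ⟨⊤, inferInstance, inferInstance, fun _ _ => rfl⟩
  add_mem' := by
    rintro f g ⟨I, hI, hIf, hfI⟩ ⟨J, hJ, hJf, hgJ⟩
    refine ⟨I ⊓ J, ⟨fun b ha => ⟨I.mul_mem_right b ha.1, J.mul_mem_right b ha.2⟩⟩, ?_, fun a ha => ?_⟩
    · let φ : (A ⧸ (I ⊓ J)) →ₗ[k] (A ⧸ I) × (A ⧸ J) :=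
        ((Submodule.factor (inf_le_left : I ⊓ J ≤ I)).prod
          (Submodule.factor (inf_le_right : I ⊓ J ≤ J))).restrictScalars k
      refine FiniteDimensional.of_injective φ ?_
      rw [injective_iff_map_eq_zero]
      intro x hx
      obtain ⟨a, rfl⟩ := Submodule.Quotient.mk_surjective _ x
      rw [Submodule.Quotient.mk_eq_zero]
      exact ⟨(Submodule.Quotient.mk_eq_zero _).1 (congrArg Prod.fst hx),
        (Submodule.Quotient.mk_eq_zero _).1 (congrArg Prod.snd hx)⟩
    · change f a + g a = 0
      rw [hfI a ha.1, hgJ a ha.2, add_zero]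
  smul_mem' := by
    rintro c f ⟨I, hI, hIf, hfI⟩
    exact ⟨I, hI, hIf, fun a ha => by change c • f a = 0; rw [hfI a ha, smul_zero]⟩

/-- The finite dual `A°`: the space of the functionals on `A` that vanish on some two-sided ideal
of finite codimension. -/
def FiniteDual : Type (max u v) := ↥(finiteDualSubmodule k A)

instance : AddCommGroup (FiniteDual k A) :=
  inferInstanceAs (AddCommGroup ↥(finiteDualSubmodule k A))

instance : Module k (FiniteDual k A) :=
  inferInstanceAs (Module k ↥(finiteDualSubmodule k A))

/-- The inclusion of `A°` in the space of all functionals on `A`. -/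
def FiniteDual.incl : FiniteDual k A →ₗ[k] (A →ₗ[k] k) := (finiteDualSubmodule k A).subtype

/-- The pairing of `A° ⊗ A°` with `A ⊗ A`, `⟨f ⊗ g, a ⊗ b⟩ = f a * g b`. -/
def finiteDualPairing :
    FiniteDual k A ⊗[k] FiniteDual k A →ₗ[k] Module.Dual k (A ⊗[k] A) :=
  TensorProduct.dualDistrib k A A ∘ₗ
    TensorProduct.map (FiniteDual.incl k A) (FiniteDual.incl k A)

variable {k A}

/-- Evaluation at `a`, as a functional on `A°`. -/
def evalAt (a : A) : FiniteDual k A →ₗ[k] k := Module.Dual.eval k A a ∘ₗ (FiniteDual.incl k A)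

theorem evalAt_apply (a : A) (f : FiniteDual k A) : evalAt a f = FiniteDual.incl k A f a := rfl

theorem evalAt_separates (f : FiniteDual k A) (h : ∀ a : A, evalAt (k := k) a f = 0) : f = 0 :=
  Subtype.ext (LinearMap.ext h)

theorem finiteDualPairing_apply (t : FiniteDual k A ⊗[k] FiniteDual k A) (a b : A) :
    finiteDualPairing k A t (a ⊗ₜ b) =
      evalAt b (TensorProduct.lid k _ ((evalAt a).rTensor (FiniteDual k A) t)) := by
  induction t with
  | zero => simp
  | tmul f g => simp [finiteDualPairing, evalAt_apply]
  | add s t hs ht => simp only [map_add, LinearMap.add_apply, hs, ht]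

theorem finiteDualPairing_injective : Function.Injective (finiteDualPairing k A) := by
  rw [injective_iff_map_eq_zero]
  intro t ht
  refine eq_zero_of_rTensor (fun a : A => evalAt a) evalAt_separates t fun a => ?_
  apply (TensorProduct.lid k _).injective
  rw [map_zero]
  refine evalAt_separates _ fun b => ?_
  rw [← finiteDualPairing_apply, ht, LinearMap.zero_apply]

/-- The multiplication of `A` carries `A°` into `A° ⊗ A°`. -/
theorem dualMap_mul_mem (f : FiniteDual k A) :
    (LinearMap.mul' k A).dualMap (FiniteDual.incl k A f) ∈ LinearMap.range (finiteDualPairing k A) := by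
  obtain ⟨f, I, hI, hfin, hf⟩ := f
  let q : A →ₗ[k] A ⧸ I := (Ideal.Quotient.mkₐ k I).toLinearMap
  have hq : ∀ a ∈ I, q a = 0 := fun a ha => Ideal.Quotient.eq_zero_iff_mem.2 ha
  let qs : Module.Dual k (A ⧸ I) →ₗ[k] FiniteDual k A :=
    q.dualMap.codRestrict (finiteDualSubmodule k A) fun h => ⟨I, hI, hfin, fun a ha => by
      change h (q a) = 0
      rw [hq a ha, map_zero]⟩
  obtain ⟨F, hF⟩ : ∃ F : (A ⧸ I) →ₗ[k] k, ∀ a, F (q a) = f a :=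
    ⟨Submodule.liftQ (I.restrictScalars k) f (fun a ha => hf a ha), fun a => rfl⟩
  let s := (TensorProduct.dualDistribEquiv k (A ⧸ I) (A ⧸ I)).symm
    ((LinearMap.mul' k (A ⧸ I)).dualMap F)
  have hs : TensorProduct.dualDistrib k (A ⧸ I) (A ⧸ I) s = (LinearMap.mul' k (A ⧸ I)).dualMap F :=
    (TensorProduct.dualDistribEquiv k (A ⧸ I) (A ⧸ I)).apply_symm_apply _
  refine ⟨TensorProduct.map qs qs s, ?_⟩
  ext a b
  have key : ∀ t, finiteDualPairing k A (TensorProduct.map qs qs t) (a ⊗ₜ b) =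
      TensorProduct.dualDistrib k (A ⧸ I) (A ⧸ I) t (q a ⊗ₜ q b) := by
    intro t
    induction t with
    | zero => simp
    | tmul x y => rfl
    | add x y hx hy => simp only [map_add, LinearMap.add_apply, hx, hy]
  change finiteDualPairing k A (TensorProduct.map qs qs s) (a ⊗ₜ b) = f (a * b)
  rw [key, hs, ← hF]
  change F (q a * q b) = F (q (a * b))
  congr 1

/-- The comultiplication of `A°`: `Δ f` is the element of `A° ⊗ A°` with
`⟨Δ f, a ⊗ b⟩ = f (a * b)`. -/
def finiteDualComul : FiniteDual k A →ₗ[k] FiniteDual k A ⊗[k] FiniteDual k A :=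
  LinearMap.codRestrictOfInjective ((LinearMap.mul' k A).dualMap ∘ₗ (FiniteDual.incl k A))
    (finiteDualPairing k A) finiteDualPairing_injective dualMap_mul_mem

theorem finiteDualPairing_comul (f : FiniteDual k A) (a b : A) :
    finiteDualPairing k A (finiteDualComul f) (a ⊗ₜ b) = FiniteDual.incl k A f (a * b) := by
  have := LinearMap.codRestrictOfInjective_comp_apply
    ((LinearMap.mul' k A).dualMap ∘ₗ (FiniteDual.incl k A))
    (finiteDualPairing k A) finiteDualPairing_injective dualMap_mul_mem f
  exact LinearMap.congr_fun this (a ⊗ₜ b)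

/-- The coalgebra structure of `A°`, dual to the algebra structure of `A`; the counit is
evaluation at `1`. -/
instance : Coalgebra k (FiniteDual k A) where
  comul := finiteDualComul
  counit := evalAt 1
  coassoc := by
    ext f
    rw [← sub_eq_zero]
    refine eq_zero_of_rTensor (fun a : A => evalAt a) evalAt_separates _ fun a => ?_
    apply (TensorProduct.lid k _).injective
    rw [map_zero]
    apply finiteDualPairing_injective
    rw [map_zero]
    ext b c
    have h1 : ∀ t : FiniteDual k A ⊗[k] FiniteDual k A,
        finiteDualPairing k A (TensorProduct.lid k _ ((evalAt a).rTensor _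
          (TensorProduct.assoc k _ _ _ (finiteDualComul.rTensor (FiniteDual k A) t)))) (b ⊗ₜ c) =
        finiteDualPairing k A t ((a * b) ⊗ₜ c) := by
      intro t
      induction t with
      | zero => simp
      | add x y hx hy => simp only [map_add, LinearMap.add_apply, hx, hy]
      | tmul x y =>
        have e : finiteDualPairing k A (x ⊗ₜ y) ((a * b) ⊗ₜ c) =
          finiteDualPairing k A (finiteDualComul x) (a ⊗ₜ b) * FiniteDual.incl k A y c := by
            rw [finiteDualPairing_comul]; rfl
        rw [e, LinearMap.rTensor_tmul]
        generalize finiteDualComul x = s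
        induction s with
        | zero => simp
        | tmul x' y' => simp [finiteDualPairing, evalAt_apply, mul_assoc]
        | add x' y' hx hy =>
          simp only [map_add, LinearMap.add_apply, TensorProduct.add_tmul, hx, hy, add_mul]
    have h2 : ∀ t : FiniteDual k A ⊗[k] FiniteDual k A,
        finiteDualPairing k A (TensorProduct.lid k _ ((evalAt a).rTensor _
          (finiteDualComul.lTensor (FiniteDual k A) t))) (b ⊗ₜ c) =
        finiteDualPairing k A t (a ⊗ₜ (b * c)) := by
      intro t
      induction t with
      | zero => simp
      | add x y hx hy => simp only [map_add, LinearMap.add_apply, hx, hy]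
      | tmul x y =>
        simp only [LinearMap.lTensor_tmul, LinearMap.rTensor_tmul, TensorProduct.lid_tmul,
          map_smul, LinearMap.smul_apply, finiteDualPairing_comul]
        rfl
    change finiteDualPairing k A (TensorProduct.lid k _ ((evalAt a).rTensor _
      (TensorProduct.assoc k _ _ _ (finiteDualComul.rTensor _ (finiteDualComul f)) -
        finiteDualComul.lTensor _ (finiteDualComul f)))) (b ⊗ₜ c) = 0
    rw [map_sub, map_sub, map_sub, LinearMap.sub_apply, h1, h2, finiteDualPairing_comul,
      finiteDualPairing_comul, mul_assoc, sub_self]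
  rTensor_counit_comp_comul := by
    ext f
    apply (TensorProduct.lid k _).injective
    rw [← sub_eq_zero]
    refine evalAt_separates _ fun b => ?_
    rw [map_sub, LinearMap.comp_apply, ← finiteDualPairing_apply, finiteDualPairing_comul]
    simp [evalAt_apply]
  lTensor_counit_comp_comul := by
    ext f
    apply (TensorProduct.rid k _).injective
    rw [← sub_eq_zero]
    refine evalAt_separates _ fun a => ?_
    have h : ∀ t : FiniteDual k A ⊗[k] FiniteDual k A,
        evalAt a (TensorProduct.rid k _ ((evalAt 1).lTensor (FiniteDual k A) t)) =
        finiteDualPairing k A t (a ⊗ₜ 1) := by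
      intro t
      induction t with
      | zero => simp
      | tmul x y => simp [finiteDualPairing, evalAt_apply, mul_comm]
      | add x y hx hy => simp only [map_add, LinearMap.add_apply, hx, hy]
    rw [map_sub, LinearMap.comp_apply, h, finiteDualPairing_comul]
    simp [evalAt_apply]

end FiniteDual

end ChainCoalg

end

/-!
Since `D` is central simple, it has a separability idempotent. Contracting the multiplicative defect
of a linear map with this idempotent gives a correction after which the defect is quadratically
small, so the isomorphism `D ≃ C₀^*` lifts to a homomorphism `D → C^*` (as in the Wedderburn–Malcev
theorem), `C^*` being complete for the filtration dual to the coradical filtration.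

The Jacobson radical `J` of `C^*` is then a `D`-bimodule, hence generated over `D` by its elements
that commute with `D`. If `C ≠ C₀`, one of these, `x`, does not vanish on a right coideal `N` that
is minimal among those not contained in `C₀`. In a chain coalgebra the kernel of the action of `x`
on `C` is comparable with `N`; it does not contain `N`, so it is contained in `C₀`. It follows
that the homomorphism `D[[x]] → C^*` separates the points of `C`, so its transpose embeds `C` in
`D[[x]]°`.
-/

noncomputable section

namespace ChainCoalg

open MulOpposite WithConv

section CentralSimple

variable {k D : Type*} [Field k] [Ring D] [Algebra k D]

theorem isSimpleModule_tensorProduct_mulOpposite [IsSimpleRing D] :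
    letI := instModuleTensorProductMop k D
    IsSimpleModule (D ⊗[k] Dᵐᵒᵖ) D := by
  let _ := instModuleTensorProductMop k D
  have smul_def (a b d : D) : (a ⊗ₜ[k] op b) • d = a * d * b :=
    AlgHom.mulLeftRight_apply k D a (op b) d
  rw [isSimpleModule_iff_toSpanSingleton_surjective]
  refine ⟨inferInstance, fun d hd ↦ LinearMap.range_eq_top.1 ?_⟩
  let I := LinearMap.range (LinearMap.toSpanSingleton (D ⊗[k] Dᵐᵒᵖ) D d)
  let J : TwoSidedIdeal D := .mk' I I.zero_mem I.add_mem I.neg_mem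
    (fun {a b} hb ↦ by
      simpa only [SetLike.mem_coe, smul_def, mul_one] using I.smul_mem (a ⊗ₜ[k] op 1) hb)
    (fun {a b} ha ↦ by
      simpa only [SetLike.mem_coe, smul_def, one_mul] using I.smul_mem (1 ⊗ₜ[k] op b) ha)
  have hdJ : d ∈ J :=
    (TwoSidedIdeal.mem_mk' ..).2 ⟨1, by simp [LinearMap.toSpanSingleton_apply]⟩
  rcases eq_bot_or_eq_top J with hJ | hJ
  · exact absurd (by simpa [hJ] using hdJ) hd
  · exact eq_top_iff.2 fun a _ ↦ (TwoSidedIdeal.mem_mk' ..).1 (hJ ▸ trivial : a ∈ J)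

theorem mulLeftRight_surjective [FiniteDimensional k D] [Algebra.IsCentral k D] [IsSimpleRing D] :
    Function.Surjective (AlgHom.mulLeftRight k D) := by
  classical
  let _ := instModuleTensorProductMop k D
  have := isSimpleModule_tensorProduct_mulOpposite (k := k) (D := D)
  have smul_def (a b d : D) : (a ⊗ₜ[k] op b) • d = a * d * b :=
    AlgHom.mulLeftRight_apply k D a (op b) d
  have end_eq_smul (φ : Module.End (D ⊗[k] Dᵐᵒᵖ) D) : ∃ c : k, ∀ d, φ d = c • d := by
    have left_mul (d) : φ d = d * φ 1 := by
      simpa only [smul_def, mul_one] using φ.map_smul (d ⊗ₜ op 1) 1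
    have right_mul (d) : φ d = φ 1 * d := by
      simpa only [smul_def, mul_one, one_mul] using φ.map_smul (1 ⊗ₜ op d) 1
    have central : φ 1 ∈ Subalgebra.center k D :=
      Subalgebra.mem_center_iff.2 fun d ↦ by rw [← left_mul, right_mul]
    obtain ⟨c, hc⟩ := Algebra.mem_bot.1 (Algebra.IsCentral.out central)
    exact ⟨c, fun d ↦ by rw [right_mul, ← hc, Algebra.smul_def]⟩
  intro f
  let f' : Module.End (Module.End (D ⊗[k] Dᵐᵒᵖ) D) D :=
    { f with
      map_smul' := fun φ d ↦ by
        obtain ⟨c, hc⟩ := end_eq_smul φ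
        change f (φ d) = φ (f d)
        rw [hc, hc, map_smul] }
  let b := Module.finBasis k D
  obtain ⟨r, hr⟩ := jacobson_density (R := D ⊗[k] Dᵐᵒᵖ) f' (Finset.univ.image b)
  exact ⟨r, b.ext fun i ↦ (hr (b i) (by simp)).symm⟩

theorem isAzumaya_of_isCentral_of_isSimpleRing [FiniteDimensional k D] [Algebra.IsCentral k D]
    [IsSimpleRing D] : IsAzumaya k D where
  eq_of_smul_eq_smul {_ _} h := (FaithfulSMul.algebraMap_injective k D) <| by
    simpa [Algebra.algebraMap_eq_smul_one] using h (1 : D)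
  bij := by
    have h : Module.finrank k (D ⊗[k] Dᵐᵒᵖ) = Module.finrank k (Module.End k D) := by
      rw [Module.finrank_tensorProduct, Module.finrank_linearMap,
        ← (opLinearEquiv k : D ≃ₗ[k] Dᵐᵒᵖ).finrank_eq]
    exact ⟨(LinearMap.injective_iff_surjective_of_finrank_eq_finrank h
      (f := (AlgHom.mulLeftRight k D).toLinearMap)).2 mulLeftRight_surjective,
      mulLeftRight_surjective⟩

end CentralSimple

section Separability

variable {k D : Type*} [CommRing k] [Ring D] [Algebra k D]

/-- A separability idempotent of `D` over `k`: an element `∑ xᵢ ⊗ yᵢ` with `∑ xᵢ yᵢ = 1` and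
`∑ a xᵢ ⊗ yᵢ = ∑ xᵢ ⊗ yᵢ a` for all `a`. The second factor is taken in `Dᵐᵒᵖ`, so that the second
condition is an equation between products in `D ⊗ Dᵐᵒᵖ`. -/
structure IsSeparabilityIdempotent (e : D ⊗[k] Dᵐᵒᵖ) : Prop where
  mulLeftRight_one : AlgHom.mulLeftRight k D e 1 = 1
  tmul_one_mul (a : D) : (a ⊗ₜ 1) * e = (1 ⊗ₜ op a) * e

theorem exists_isSeparabilityIdempotent (k D : Type*) [Field k] [Ring D] [Nontrivial D]
    [Algebra k D] [IsAzumaya k D] : ∃ e : D ⊗[k] Dᵐᵒᵖ, IsSeparabilityIdempotent e := by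
  obtain ⟨l, hl⟩ := Module.Projective.exists_dual_eq_one k (one_ne_zero (α := D))
  obtain ⟨e, he⟩ := IsAzumaya.bij.2 (l.smulRight (1 : D))
  exact ⟨e, by simp [he, hl], fun a ↦ IsAzumaya.bij.1 <| by ext d; simp [he]⟩

/-- The homomorphism `D ⊗ Dᵐᵒᵖ → End A` that describes the `D`-bimodule structure of `A` coming from
`ψ : D → A`: it sends `a ⊗ b` to `x ↦ ψ a * x * ψ b`. -/
def bimoduleAction {A : Type*} [Ring A] [Algebra k A] (ψ : D →ₐ[k] A) :
    D ⊗[k] Dᵐᵒᵖ →ₐ[k] Module.End k A :=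
  (AlgHom.mulLeftRight k A).comp (Algebra.TensorProduct.map ψ ψ.op)

variable {A : Type*} [Ring A] [Algebra k A] (ψ : D →ₐ[k] A)

theorem bimoduleAction_tmul (a b : D) (x : A) :
    bimoduleAction ψ (a ⊗ₜ op b) x = ψ a * x * ψ b := by
  simp [bimoduleAction]

theorem bimoduleAction_mem {I : Submodule k A} (hl : ∀ d, ∀ x ∈ I, ψ d * x ∈ I)
    (hr : ∀ d, ∀ x ∈ I, x * ψ d ∈ I) (t : D ⊗[k] Dᵐᵒᵖ) {x : A} (hx : x ∈ I) :
    bimoduleAction ψ t x ∈ I := by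
  induction t with
  | zero => simp
  | tmul a b => simpa [bimoduleAction] using hr _ _ (hl a x hx)
  | add s t hs ht => simpa using I.add_mem hs ht

theorem le_inf_centralizer_mul_range [IsAzumaya k D] [Module.Free k D] {I : Submodule k A}
    (hl : ∀ d, ∀ x ∈ I, ψ d * x ∈ I) (hr : ∀ d, ∀ x ∈ I, x * ψ d ∈ I) :
    I ≤ (I ⊓ (Subalgebra.centralizer k (Set.range ψ)).toSubmodule) * ψ.range.toSubmodule := by
  intro x hx
  let b := Module.Free.chooseBasis k D
  choose v hv using fun j ↦ IsAzumaya.bij.2 ((b.coord j).smulRight (1 : D))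
  have central (d : D) (j) : (d ⊗ₜ 1) * v j = (1 ⊗ₜ op d) * v j :=
    IsAzumaya.bij.1 <| by ext c; simp [hv]
  have sum_eq_one : ∑ j, (1 ⊗ₜ op (b j)) * v j = 1 :=
    IsAzumaya.bij.1 <| by ext d; simp [hv, b.sum_repr]
  have commute (d : D) (j) : ψ d * bimoduleAction ψ (v j) x = bimoduleAction ψ (v j) x * ψ d := by
    have := DFunLike.congr_fun (congrArg (bimoduleAction ψ) (central d j)) x
    simpa [← op_one, bimoduleAction_tmul] using this
  have x_eq : x = ∑ j, bimoduleAction ψ (v j) x * ψ (b j) := by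
    have := DFunLike.congr_fun (congrArg (bimoduleAction ψ) sum_eq_one) x
    simpa [bimoduleAction_tmul] using this.symm
  rw [x_eq]
  refine Submodule.sum_mem _ fun j _ ↦ Submodule.mul_mem_mul
    ⟨bimoduleAction_mem ψ hl hr _ hx, ?_⟩ ⟨b j, rfl⟩
  rintro _ ⟨d, rfl⟩
  exact commute d j

end Separability

section Lifting

variable {k D A : Type*} [CommRing k] [Ring D] [Algebra k D] [Ring A] [Algebra k A]

/-- The failure `s a * s b - s (a * b)` of a linear map `s` to be multiplicative. It is a Hochschild
cocycle up to terms that are quadratic in it. -/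
def mulDefect (s : D →ₗ[k] A) : D →ₗ[k] D →ₗ[k] A :=
  (LinearMap.mul k A).compl₁₂ s s - (LinearMap.mul k D).compr₂ s

theorem mulDefect_apply (s : D →ₗ[k] A) (a b : D) : mulDefect s a b = s a * s b - s (a * b) :=
  rfl

theorem mul_mulDefect (s : D →ₗ[k] A) (a b c : D) :
    s a * mulDefect s b c =
      mulDefect s (a * b) c - mulDefect s a (b * c) + mulDefect s a b * s c := by
  simp only [mulDefect_apply, mul_assoc]
  noncomm_ring

/-- A linear map between algebras that preserves the unit and products modulo `I`. -/
structure IsAlgHomModulo (I : Ideal A) (s : D →ₗ[k] A) : Prop where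
  map_one_sub_one_mem : s 1 - 1 ∈ I
  mulDefect_mem (a b : D) : mulDefect s a b ∈ I

/-- The cochain `a ↦ ∑ s x * mulDefect s y a` obtained by contracting `mulDefect s` with the element
`∑ x ⊗ y` of `D ⊗ Dᵐᵒᵖ`. -/
def contractMulDefect (S : Finset (D × Dᵐᵒᵖ)) (s : D →ₗ[k] A) : D →ₗ[k] A :=
  ∑ p ∈ S, LinearMap.mulLeft k (s p.1) ∘ₗ mulDefect s p.2.unop

theorem contractMulDefect_apply (S : Finset (D × Dᵐᵒᵖ)) (s : D →ₗ[k] A) (a : D) :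
    contractMulDefect S s a = ∑ p ∈ S, s p.1 * mulDefect s p.2.unop a := by
  simp [contractMulDefect]

theorem contractMulDefect_mem (S : Finset (D × Dᵐᵒᵖ)) {s : D →ₗ[k] A} {I : Ideal A}
    (hs : IsAlgHomModulo I s) (a : D) : contractMulDefect S s a ∈ I := by
  rw [contractMulDefect_apply]
  exact sum_mem fun p _ ↦ I.mul_mem_left _ (hs.mulDefect_mem _ _)

namespace IsSeparabilityIdempotent

variable {S : Finset (D × Dᵐᵒᵖ)}

theorem sum_mul_unop (hS : IsSeparabilityIdempotent (∑ p ∈ S, p.1 ⊗ₜ[k] p.2)) :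
    ∑ p ∈ S, p.1 * p.2.unop = 1 := by
  simpa [AlgHom.mulLeftRight_apply] using hS.mulLeftRight_one

theorem sum_apply_mul_left {M : Type*} [AddCommGroup M] [Module k M]
    (hS : IsSeparabilityIdempotent (∑ p ∈ S, p.1 ⊗ₜ[k] p.2)) (β : D →ₗ[k] D →ₗ[k] M) (a : D) :
    ∑ p ∈ S, β (a * p.1) p.2.unop = ∑ p ∈ S, β p.1 (p.2.unop * a) := by
  simpa [Finset.mul_sum] using congrArg (TensorProduct.lift (β.compl₂
    (opLinearEquiv k).symm.toLinearMap)) (hS.tmul_one_mul a)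

variable (hS : IsSeparabilityIdempotent (∑ p ∈ S, p.1 ⊗ₜ[k] p.2)) (s : D →ₗ[k] A) (a b : D)
include hS

theorem map_mul_contractMulDefect :
    s a * contractMulDefect S s b = ∑ p ∈ S, mulDefect s a p.1 * mulDefect s p.2.unop b +
      ∑ p ∈ S, s p.1 * mulDefect s (p.2.unop * a) b := by
  have comm := hS.sum_apply_mul_left ((LinearMap.mul k A).compl₁₂ s ((mulDefect s).flip b)) a
  simp only [LinearMap.compl₁₂_apply, LinearMap.mul_apply', LinearMap.flip_apply] at comm
  rw [← comm, contractMulDefect_apply, Finset.mul_sum, ← Finset.sum_add_distrib]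
  refine Finset.sum_congr rfl fun p _ ↦ ?_
  rw [mulDefect_apply s a]
  noncomm_ring

theorem contractMulDefect_mul_map :
    contractMulDefect S s a * s b = contractMulDefect S s (a * b)
      + (∑ p ∈ S, mulDefect s p.1 p.2.unop + s 1) * mulDefect s a b
      - ∑ p ∈ S, s p.1 * mulDefect s (p.2.unop * a) b := by
  have sum_eq : ∑ p ∈ S, mulDefect s p.1 p.2.unop + s 1 = ∑ p ∈ S, s p.1 * s p.2.unop := by
    simp [mulDefect_apply, ← hS.sum_mul_unop]
  simp only [sum_eq, contractMulDefect_apply, Finset.sum_mul, ← Finset.sum_add_distrib,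
    ← Finset.sum_sub_distrib]
  refine Finset.sum_congr rfl fun p _ ↦ ?_
  rw [mul_assoc (s p.1) (s p.2.unop), mul_mulDefect s p.2.unop]
  noncomm_ring

theorem mulDefect_sub_contractMulDefect :
    mulDefect (s - contractMulDefect S s) a b =
      contractMulDefect S s a * contractMulDefect S s b
      - ∑ p ∈ S, mulDefect s a p.1 * mulDefect s p.2.unop b
      - (∑ p ∈ S, mulDefect s p.1 p.2.unop + (s 1 - 1)) * mulDefect s a b := by
  have expand : mulDefect (s - contractMulDefect S s) a b = mulDefect s a b
      - s a * contractMulDefect S s b - contractMulDefect S s a * s b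
      + contractMulDefect S s (a * b) + contractMulDefect S s a * contractMulDefect S s b := by
    simp only [mulDefect_apply, LinearMap.sub_apply]
    noncomm_ring
  rw [expand, hS.map_mul_contractMulDefect, hS.contractMulDefect_mul_map]
  noncomm_ring

end IsSeparabilityIdempotent

theorem IsSeparabilityIdempotent.exists_isAlgHomModulo {e : D ⊗[k] Dᵐᵒᵖ}
    (he : IsSeparabilityIdempotent e) {F F' : Ideal A} (hF : ∀ f ∈ F, ∀ g ∈ F, f * g ∈ F')
    {s : D →ₗ[k] A} (hs : IsAlgHomModulo F s) :
    ∃ s' : D →ₗ[k] A, IsAlgHomModulo F' s' ∧ ∀ a, s' a - s a ∈ F := by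
  obtain ⟨S, rfl⟩ := TensorProduct.exists_finset e
  have sub_mem_F (a) : (s - contractMulDefect S s) a - s a ∈ F := by
    simpa using contractMulDefect_mem S hs a
  have defect_mem (a b) : mulDefect (s - contractMulDefect S s) a b ∈ F' := by
    rw [he.mulDefect_sub_contractMulDefect]
    refine sub_mem (sub_mem ?_ ?_) ?_
    · exact hF _ (contractMulDefect_mem S hs a) _ (contractMulDefect_mem S hs b)
    · exact sum_mem fun p _ ↦ hF _ (hs.mulDefect_mem _ _) _ (hs.mulDefect_mem _ _)
    · exact hF _ (add_mem (sum_mem fun p _ ↦ hs.mulDefect_mem _ _) hs.map_one_sub_one_mem) _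
        (hs.mulDefect_mem a b)
  refine ⟨s - contractMulDefect S s, ⟨?_, defect_mem⟩, sub_mem_F⟩
  set u := (s - contractMulDefect S s) 1 with hu
  have u_sub_one_mem : u - 1 ∈ F := by
    rw [← sub_add_sub_cancel u (s 1)]
    exact add_mem (sub_mem_F 1) hs.map_one_sub_one_mem
  have eq_sub : u - 1 = (u * u - u) - (u - 1) * (u - 1) := by noncomm_ring
  rw [eq_sub]
  exact sub_mem (by simpa [mulDefect_apply, hu] using defect_mem 1 1)
    (hF _ u_sub_one_mem _ u_sub_one_mem)

end Lifting

section CompleteFiltration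

variable {k A : Type*} [CommRing k] [Ring A] [Algebra k A]

/-- A descending multiplicative filtration of a ring by ideals `F 0 = ⊤ ⊇ F 1 ⊇ ⋯`, such that the
ring is Hausdorff and complete in the topology it defines. The ideals are two-sided, see
`IsCompleteFiltration.isTwoSided`. -/
structure IsCompleteFiltration (F : ℕ → Ideal A) : Prop where
  antitone : Antitone F
  zero_eq_top : F 0 = ⊤
  mul_mem {m n : ℕ} {a b : A} (ha : a ∈ F m) (hb : b ∈ F n) : a * b ∈ F (m + n)
  eq_zero_of_forall_mem {a : A} (ha : ∀ n, a ∈ F n) : a = 0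
  exists_limit (a : ℕ → A) (ha : ∀ n, a (n + 1) - a n ∈ F n) : ∃ b, ∀ n, b - a n ∈ F n

namespace IsCompleteFiltration

variable {F : ℕ → Ideal A} (hF : IsCompleteFiltration F)
include hF

theorem isTwoSided (n : ℕ) : (F n).IsTwoSided :=
  ⟨fun b ha ↦ by simpa using hF.mul_mem ha (hF.zero_eq_top ▸ Submodule.mem_top : b ∈ F 0)⟩

theorem pow_mem {x : A} (hx : x ∈ F 1) (n : ℕ) : x ^ n ∈ F n := by
  induction n with
  | zero => simp [hF.zero_eq_top]
  | succ n ih => exact pow_succ x n ▸ hF.mul_mem ih hx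

theorem exists_linearMap_limit {M : Type*} [AddCommGroup M] [Module k M] (s : ℕ → M →ₗ[k] A)
    (hs : ∀ n m, s (n + 1) m - s n m ∈ F n) :
    ∃ t : M →ₗ[k] A, ∀ n m, t m - s n m ∈ F n := by
  choose t ht using fun m ↦ hF.exists_limit (fun n ↦ s n m) fun n ↦ hs n m
  refine ⟨⟨⟨t, fun m m' ↦ ?_⟩, fun c m ↦ ?_⟩, fun n m ↦ ht m n⟩
  · refine sub_eq_zero.1 (hF.eq_zero_of_forall_mem fun n ↦ ?_)
    have := sub_mem (ht (m + m') n) (add_mem (ht m n) (ht m' n))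
    rw [map_add] at this
    convert this using 1
    abel
  · refine sub_eq_zero.1 (hF.eq_zero_of_forall_mem fun n ↦ ?_)
    have := sub_mem (ht (c • m) n) (Submodule.smul_of_tower_mem (F n) c (ht m n))
    rw [map_smul, smul_sub, sub_sub_sub_cancel_right] at this
    exact this

theorem exists_algHom_limit {B : Type*} [Ring B] [Algebra k B] (s : ℕ → B →ₗ[k] A)
    (hs : ∀ n b, s (n + 1) b - s n b ∈ F n) (hmul : ∀ n, IsAlgHomModulo (F n) (s n)) :
    ∃ t : B →ₐ[k] A, ∀ n b, t b - s n b ∈ F n := by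
  obtain ⟨t, ht⟩ := hF.exists_linearMap_limit s hs
  have map_one : t 1 = 1 := sub_eq_zero.1 <| hF.eq_zero_of_forall_mem fun n ↦ by
    rw [← sub_add_sub_cancel (t 1) (s n 1)]
    exact add_mem (ht n 1) (hmul n).map_one_sub_one_mem
  have map_mul (a b : B) : t (a * b) = t a * t b :=
    sub_eq_zero.1 <| hF.eq_zero_of_forall_mem fun n ↦ by
      have := hF.isTwoSided n
      have eq_sub : t (a * b) - t a * t b = (t (a * b) - s n (a * b)) - mulDefect (s n) a b
          - (t a * t b - s n a * s n b) := by
        rw [mulDefect_apply]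
        abel
      rw [eq_sub]
      exact sub_mem (sub_mem (ht n _) ((hmul n).mulDefect_mem a b))
        (Ideal.mul_sub_mul_mem (F n) (ht n a) (ht n b))
  exact ⟨AlgHom.ofLinearMap t map_one map_mul, ht⟩

theorem exists_algHom_lift {D B : Type*} [Ring D] [Algebra k D] [Module.Projective k D] [Ring B]
    [Algebra k B] {e : D ⊗[k] Dᵐᵒᵖ} (he : IsSeparabilityIdempotent e) {π : A →ₐ[k] B}
    (hπ : Function.Surjective π) (hker : RingHom.ker π = F 1) (φ : D →ₐ[k] B) :
    ∃ ψ : D →ₐ[k] A, π.comp ψ = φ := by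
  have mem_F_one {a : A} : a ∈ F 1 ↔ π a = 0 := by rw [← hker, RingHom.mem_ker]
  obtain ⟨s₀, hs₀⟩ := Module.projective_lifting_property π.toLinearMap φ.toLinearMap hπ
  have π_s₀ (d : D) : π (s₀ d) = φ d := LinearMap.congr_fun hs₀ d
  have hs₀ : IsAlgHomModulo (F 1) s₀ :=
    ⟨by simp [mem_F_one, π_s₀], fun a b ↦ by simp [mem_F_one, mulDefect_apply, π_s₀]⟩
  have step (n : ℕ) (s : {s : D →ₗ[k] A // IsAlgHomModulo (F (n + 1)) s}) :
      ∃ s' : {s : D →ₗ[k] A // IsAlgHomModulo (F (n + 2)) s},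
        ∀ d, s'.1 d - s.1 d ∈ F (n + 1) := by
    obtain ⟨s', hs', hsub⟩ := he.exists_isAlgHomModulo (F' := F (n + 2))
      (fun f hf g hg ↦ hF.antitone (by omega) (hF.mul_mem hf hg)) s.2
    exact ⟨⟨s', hs'⟩, hsub⟩
  choose next hnext using step
  let s (n : ℕ) : {s : D →ₗ[k] A // IsAlgHomModulo (F (n + 1)) s} :=
    n.rec ⟨s₀, hs₀⟩ next
  obtain ⟨ψ, hψ⟩ := hF.exists_algHom_limit (fun n ↦ (s n).1)
    (fun n d ↦ hF.antitone n.le_succ (hnext n (s n) d))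
    (fun n ↦ ⟨hF.antitone n.le_succ (s n).2.map_one_sub_one_mem,
      fun a b ↦ hF.antitone n.le_succ ((s n).2.mulDefect_mem a b)⟩)
  refine ⟨ψ, AlgHom.ext fun d ↦ ?_⟩
  have : ψ d - s₀ d ∈ F 1 := by
    rw [← sub_add_sub_cancel _ ((s 1).1 d)]
    exact add_mem (hψ 1 d) (hnext 0 (s 0) d)
  rw [mem_F_one, map_sub, sub_eq_zero, π_s₀] at this
  exact this

end IsCompleteFiltration

end CompleteFiltration

section PowerSeriesEvaluation

open Polynomial

theorem coeff_trunc_mul_trunc_of_lt {R : Type*} [Semiring R] (p q : PowerSeries R) {i n : ℕ}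
    (hi : i < n) : (p.trunc n * q.trunc n).coeff i = (p * q).coeff i := by
  rw [PowerSeries.coeff_mul, coeff_mul]
  refine Finset.sum_congr rfl fun ij hij ↦ ?_
  have := Finset.HasAntidiagonal.mem_antidiagonal.1 hij
  rw [PowerSeries.coeff_trunc, PowerSeries.coeff_trunc, if_pos (by omega), if_pos (by omega)]

namespace IsCompleteFiltration

variable {k A : Type*} [CommRing k] [Ring A] [Algebra k A] {F : ℕ → Ideal A}
  {D : Type*} [Ring D] [Algebra k D]

theorem eval₂_sub_eval₂_mem (hF : IsCompleteFiltration F) (ψ : D →ₐ[k] A) {x : A} (hx : x ∈ F 1)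
    (hcomm : ∀ d, Commute (ψ d) x) {n : ℕ} {p q : D[X]} (h : ∀ i < n, p.coeff i = q.coeff i) :
    eval₂AlgHom ψ x hcomm p - eval₂AlgHom ψ x hcomm q ∈ F n := by
  obtain ⟨r, hr⟩ : X ^ n ∣ p - q :=
    X_pow_dvd_iff.2 fun i hi ↦ by rw [coeff_sub, h i hi, sub_self]
  have := hF.isTwoSided n
  rw [← map_sub, hr, map_mul, map_pow]
  exact Ideal.mul_mem_right _ _ (hF.pow_mem (by simpa using hx) n)

theorem exists_powerSeries_algHom (hF : IsCompleteFiltration F) (ψ : D →ₐ[k] A) {x : A}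
    (hx : x ∈ F 1) (hcomm : ∀ d, Commute (ψ d) x) :
    ∃ Φ : PowerSeries D →ₐ[k] A, (∀ d, Φ (PowerSeries.C d) = ψ d) ∧ Φ PowerSeries.X = x := by
  let E : D[X] →ₐ[k] A := eval₂AlgHom ψ x hcomm
  have E_sub_mem {n : ℕ} {p q : D[X]} : (∀ i < n, p.coeff i = q.coeff i) → E p - E q ∈ F n :=
    hF.eval₂_sub_eval₂_mem ψ hx hcomm
  let s (n : ℕ) : PowerSeries D →ₗ[k] A :=
    E.toLinearMap ∘ₗ (PowerSeries.trunc n).restrictScalars k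
  have s_apply (n : ℕ) (p : PowerSeries D) : s n p = E (p.trunc n) := rfl
  have hs (n : ℕ) : IsAlgHomModulo (F n) (s n) := by
    refine ⟨?_, fun p q ↦ ?_⟩
    · rw [s_apply, ← map_one E]
      exact E_sub_mem fun i hi ↦ by
        simp [PowerSeries.coeff_trunc, hi, PowerSeries.coeff_one, coeff_one]
    · simp only [mulDefect_apply, s_apply, ← map_mul E]
      exact E_sub_mem fun i hi ↦ by
        rw [coeff_trunc_mul_trunc_of_lt p q hi, PowerSeries.coeff_trunc, if_pos hi]
  obtain ⟨Φ, hΦ⟩ := hF.exists_algHom_limit s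
    (fun n p ↦ E_sub_mem fun i hi ↦ by simp [PowerSeries.coeff_trunc, hi, hi.trans n.lt_succ_self])
    hs
  have Φ_eq {p : PowerSeries D} {q : D[X]} (h : ∀ n, p.trunc (n + 2) = q) : Φ p = E q :=
    sub_eq_zero.1 <| hF.eq_zero_of_forall_mem fun n ↦
      hF.antitone (Nat.le_add_right n 2) (h n ▸ hΦ (n + 2) p)
  refine ⟨Φ, fun d ↦ ?_, ?_⟩
  · rw [Φ_eq fun n ↦ PowerSeries.trunc_C (n + 1) d]
    simp [E]
  · rw [Φ_eq PowerSeries.trunc_X]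
    simp [E]

end IsCompleteFiltration

end PowerSeriesEvaluation

section DualAlgebra

variable {k C : Type*} [Field k] [AddCommGroup C] [Module k C] [Coalgebra k C]

variable (k C) in
/-- The dual algebra `C^*` of a coalgebra `C`, with the convolution product. -/
abbrev DualAlgebra : Type _ := WithConv (C →ₗ[k] k)

namespace DualAlgebra

omit [Coalgebra k C] in
theorem eq_of_forall_apply_eq {c d : C} (h : ∀ f : DualAlgebra k C, f c = f d) : c = d :=
  sub_eq_zero.1 <| eq_of_all_dual (k := k) _ fun f ↦ by
    rw [map_sub, sub_eq_zero]
    exact h (toConv f)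

theorem mul_apply_eq_apply_leftHit (f g : DualAlgebra k C) (c : C) :
    (f * g) c = f (leftHit g.ofConv c) := by
  rw [LinearMap.convMul_apply, leftHit]
  simp only [LinearMap.comp_apply, LinearEquiv.coe_coe]
  induction Coalgebra.comul (R := k) c with
  | zero => simp
  | tmul a b => simp [mul_comm]
  | add s t hs ht => simp only [map_add, hs, ht]

theorem mul_apply_eq_apply_rightHit (f g : DualAlgebra k C) (c : C) :
    (f * g) c = g (rightHit f.ofConv c) := by
  rw [LinearMap.convMul_apply, rightHit]
  simp only [LinearMap.comp_apply, LinearEquiv.coe_coe]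
  induction Coalgebra.comul (R := k) c with
  | zero => simp
  | tmul a b => simp
  | add s t hs ht => simp only [map_add, hs, ht]

end DualAlgebra

open DualAlgebra

theorem leftHit_one (c : C) : leftHit (1 : DualAlgebra k C).ofConv c = c :=
  eq_of_forall_apply_eq (k := k) fun h ↦ by rw [← mul_apply_eq_apply_leftHit, mul_one]

theorem leftHit_mul (f g : DualAlgebra k C) (c : C) :
    leftHit (f * g).ofConv c = leftHit f.ofConv (leftHit g.ofConv c) :=
  eq_of_forall_apply_eq (k := k) fun h ↦ by
    simp only [← mul_apply_eq_apply_leftHit, mul_assoc]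

/-- The comodule structure of a right coideal, seen as an action of the dual algebra. -/
def coidealAction {N : Submodule k C} (hN : IsRightCoideal N) :
    DualAlgebra k C →ₐ[k] Module.End k N :=
  AlgHom.ofLinearMap
    { toFun f := (leftHit f.ofConv).restrict ((isRightCoideal_iff N).1 hN f.ofConv)
      map_add' f g := by ext; simp [leftHit, LinearMap.lTensor_add]
      map_smul' r f := by ext; simp [leftHit, LinearMap.lTensor_smul] }
    (LinearMap.ext fun c ↦ Subtype.ext (leftHit_one c.1))
    fun f g ↦ LinearMap.ext fun c ↦ Subtype.ext (leftHit_mul f g c.1)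

theorem isRightCoideal_top : IsRightCoideal (⊤ : Submodule k C) :=
  (isRightCoideal_iff _).2 fun _ _ _ ↦ Submodule.mem_top

theorem exists_isRightCoideal_finiteDimensional_mem (c : C) :
    ∃ N : Submodule k C, IsRightCoideal N ∧ FiniteDimensional k N ∧ c ∈ N := by
  let orbitMap : DualAlgebra k C →ₗ[k] C := (⊤ : Submodule k C).subtype ∘ₗ
    (coidealAction isRightCoideal_top).toLinearMap.flip ⟨c, Submodule.mem_top⟩
  have range_le : ∃ V : Submodule k C, FiniteDimensional k V ∧ LinearMap.range orbitMap ≤ V := by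
    obtain ⟨S, hS⟩ := TensorProduct.exists_finset (Coalgebra.comul (R := k) c)
    refine ⟨Submodule.span k (Prod.fst '' (S : Set (C × C))),
      FiniteDimensional.span_of_finite k (S.finite_toSet.image _), ?_⟩
    rintro _ ⟨f, rfl⟩
    have orbitMap_apply : orbitMap f = ∑ p ∈ S, f p.2 • p.1 := by
      change leftHit f.ofConv c = _
      simp [leftHit, hS]
    rw [orbitMap_apply]
    exact Submodule.sum_mem _ fun p hp ↦
      Submodule.smul_mem _ _ (Submodule.subset_span ⟨p, hp, rfl⟩)
  obtain ⟨V, hV, hle⟩ := range_le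
  refine ⟨LinearMap.range orbitMap, (isRightCoideal_iff _).2 ?_,
    Submodule.finiteDimensional_of_le hle, 1, leftHit_one c⟩
  rintro f _ ⟨g, rfl⟩
  exact ⟨toConv f * g, leftHit_mul _ _ _⟩

theorem isRightCoideal_ker_rightHit (g : C →ₗ[k] k) :
    IsRightCoideal (LinearMap.ker (rightHit g)) :=
  (isRightCoideal_iff _).2 fun f c hc ↦ by
    rw [LinearMap.mem_ker, ← leftHit_rightHit, LinearMap.mem_ker.1 hc, map_zero]

theorem inf_socle_ne_bot {N : Submodule k C} [FiniteDimensional k N] (hN : IsRightCoideal N)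
    (h0 : N ≠ ⊥) : N ⊓ socle k C ≠ ⊥ := by
  induction hn : Module.finrank k N using Nat.strong_induction_on generalizing N with
  | _ n ih =>
    subst hn
    by_cases hs : IsSimpleRightCoideal N
    · have hle : N ≤ socle k C := le_sSup hs
      rwa [inf_eq_left.2 hle]
    · obtain ⟨M, hM, hMN, hM0, hne⟩ : ∃ M : Submodule k C,
          IsRightCoideal M ∧ M ≤ N ∧ M ≠ ⊥ ∧ M ≠ N := by
        by_contra! h
        exact hs ⟨hN, h0, fun M hM hMN ↦ or_iff_not_imp_left.2 (h M hM hMN)⟩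
      have := Submodule.finiteDimensional_of_le hMN
      have hM_inf := ih _ (Submodule.finrank_lt_finrank_of_lt (hMN.lt_of_ne hne)) hM hM0 rfl
      exact ne_bot_of_le_ne_bot hM_inf (inf_le_inf_right _ hMN)

namespace Subcoalgebra

theorem mul_apply_coe (E : Subcoalgebra k C) (f g : DualAlgebra k C) (c : E) :
    (f * g) c = (toConv (f.ofConv ∘ₗ E.carrier.subtype) *
      toConv (g.ofConv ∘ₗ E.carrier.subtype)) c := by
  rw [LinearMap.convMul_apply, LinearMap.convMul_apply, ← E.map_comul, ofConv_toConv,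
    ofConv_toConv, TensorProduct.map_comp]
  rfl

/-- Restriction of functionals to a subcoalgebra, a homomorphism of dual algebras. -/
def restrict (E : Subcoalgebra k C) : DualAlgebra k C →ₐ[k] DualAlgebra k E :=
  AlgHom.ofLinearMap
    { toFun f := toConv (f.ofConv ∘ₗ E.carrier.subtype)
      map_add' _ _ := rfl
      map_smul' _ _ := rfl }
    rfl fun f g ↦ WithConv.ext (LinearMap.ext fun c ↦ E.mul_apply_coe f g c)

theorem restrict_surjective (E : Subcoalgebra k C) : Function.Surjective E.restrict := fun f ↦ by
  obtain ⟨p, hp⟩ := exists_projection E.carrier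
  exact ⟨toConv (f.ofConv ∘ₗ p), WithConv.ext (LinearMap.ext fun c ↦
    congrArg f.ofConv (LinearMap.congr_fun hp c))⟩

theorem mem_ker_restrict {E : Subcoalgebra k C} {f : DualAlgebra k C} :
    f ∈ RingHom.ker E.restrict ↔ ∀ c ∈ E.carrier, f c = 0 :=
  ⟨fun h c hc ↦ congrArg (fun g : DualAlgebra k E ↦ g ⟨c, hc⟩) h,
    fun h ↦ WithConv.ext (LinearMap.ext fun c ↦ h c c.2)⟩

end Subcoalgebra

end DualAlgebra

section CoradicalFiltration

open DualAlgebra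

variable {k C : Type*} [Field k] [AddCommGroup C] [Module k C] [Coalgebra k C]

/-- The orthogonal complement in `C` of a two-sided ideal of `C^*`, which is a subcoalgebra. -/
def coannihilator (I : Ideal (DualAlgebra k C)) [I.IsTwoSided] : Subcoalgebra k C where
  carrier :=
    { carrier := {c | ∀ f ∈ I, f c = 0}
      zero_mem' := fun _ _ ↦ map_zero _
      add_mem' := fun hc hd f hf ↦ by rw [map_add, hc f hf, hd f hf, add_zero]
      smul_mem' := fun r c hc f hf ↦ by rw [map_smul, hc f hf, smul_zero] }
  comul_mem := comul_mem_of_hit _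
    ((isRightCoideal_iff _).2 fun f c hc g hg ↦
      mul_apply_eq_apply_leftHit g (toConv f) c ▸ hc _ (I.mul_mem_right _ hg))
    fun f c hc g hg ↦ mul_apply_eq_apply_rightHit (toConv f) g c ▸ hc _ (I.mul_mem_left _ hg)

variable (k C)

/-- The ideal of `C^*` of the functionals that vanish on the coradical of `C`. It is the Jacobson
radical of `C^*`. -/
def dualRadical : Ideal (DualAlgebra k C) := RingHom.ker (coradical k C).restrict

instance : (dualRadical k C).IsTwoSided := inferInstanceAs (RingHom.ker _).IsTwoSided

/-- The coradical filtration of `C`, indexed so that the coradical is its term of index `1`. -/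
def coradicalFiltration (n : ℕ) : Subcoalgebra k C := coannihilator (dualRadical k C ^ n)

variable {k C}

theorem mem_dualRadical {f : DualAlgebra k C} :
    f ∈ dualRadical k C ↔ ∀ c ∈ socle k C, f c = 0 :=
  Subcoalgebra.mem_ker_restrict

theorem mem_socle_of_forall_mem_dualRadical {c : C} (hc : ∀ f ∈ dualRadical k C, f c = 0) :
    c ∈ socle k C := by
  rw [← Subspace.dualAnnihilator_dualCoannihilator_eq (W := socle k C),
    Submodule.mem_dualCoannihilator]
  exact fun f hf ↦ hc (toConv f) (mem_dualRadical.2 ((Submodule.mem_dualAnnihilator f).1 hf))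

theorem mem_coradicalFiltration_zero {c : C} :
    c ∈ (coradicalFiltration k C 0).carrier ↔ c = 0 := by
  refine ⟨fun h ↦ eq_of_forall_apply_eq (k := k) fun f ↦ ?_, fun h ↦ h ▸ zero_mem _⟩
  rw [map_zero]
  exact h f (by rw [Submodule.pow_zero, Ideal.one_eq_top]; exact Submodule.mem_top)

theorem coradicalFiltration_one : (coradicalFiltration k C 1).carrier = socle k C :=
  le_antisymm
    (fun _ hc ↦ mem_socle_of_forall_mem_dualRadical fun f hf ↦
      hc f ((dualRadical k C).pow_one.symm ▸ hf))
    fun c hc _ hf ↦ mem_dualRadical.1 ((dualRadical k C).pow_one ▸ hf) c hc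

theorem coradicalFiltration_mono : Monotone fun n ↦ (coradicalFiltration k C n).carrier :=
  fun _ _ h _ hc f hf ↦ hc f (Ideal.pow_le_pow_right h hf)

theorem leftHit_mem_coradicalFiltration {m n : ℕ} {f : DualAlgebra k C}
    (hf : f ∈ dualRadical k C ^ n) {c : C} (hc : c ∈ (coradicalFiltration k C (m + n)).carrier) :
    leftHit f.ofConv c ∈ (coradicalFiltration k C m).carrier := fun g hg ↦ by
  rw [← mul_apply_eq_apply_leftHit]
  exact hc _ (Ideal.IsTwoSided.pow_add m n (I := dualRadical k C) ▸ Ideal.mul_mem_mul hg hf)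

theorem rightHit_mem_coradicalFiltration {m n : ℕ} {f : DualAlgebra k C}
    (hf : ∀ d ∈ (coradicalFiltration k C m).carrier, f d = 0) {c : C}
    (hc : c ∈ (coradicalFiltration k C (m + n)).carrier) :
    rightHit f.ofConv c ∈ (coradicalFiltration k C n).carrier := fun g hg ↦ by
  rw [← mul_apply_eq_apply_rightHit, mul_apply_eq_apply_leftHit]
  exact hf _ (leftHit_mem_coradicalFiltration hg hc)

theorem mul_apply_eq_zero_of_mem_coradicalFiltration {m n : ℕ} {f g : DualAlgebra k C}
    (hf : ∀ c ∈ (coradicalFiltration k C m).carrier, f c = 0)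
    (hg : ∀ c ∈ (coradicalFiltration k C n).carrier, g c = 0) {c : C}
    (hc : c ∈ (coradicalFiltration k C (m + n)).carrier) : (f * g) c = 0 := by
  rw [mul_apply_eq_apply_rightHit]
  exact hg _ (rightHit_mem_coradicalFiltration hf hc)

theorem rightHit_eq_zero_of_mem_socle {f : DualAlgebra k C} (hf : f ∈ dualRadical k C) {c : C}
    (hc : c ∈ socle k C) : rightHit f.ofConv c = 0 := by
  rw [← coradicalFiltration_one] at hc
  refine mem_coradicalFiltration_zero (k := k).1
    (rightHit_mem_coradicalFiltration (m := 1) (n := 0) ?_ hc)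
  rw [coradicalFiltration_one]
  exact mem_dualRadical.1 hf

theorem finrank_map_rightHit_lt {N : Submodule k C} [FiniteDimensional k N]
    (hN : IsRightCoideal N) (h0 : N ≠ ⊥) {f : DualAlgebra k C} (hf : f ∈ dualRadical k C) :
    Module.finrank k (N.map (rightHit f.ofConv)) < Module.finrank k N := by
  obtain ⟨c, hc, hc0⟩ := Submodule.exists_mem_ne_zero_of_ne_bot (inf_socle_ne_bot hN h0)
  have ker_ne_bot : LinearMap.ker ((rightHit f.ofConv).domRestrict N) ≠ ⊥ := fun h ↦ hc0 <| by
    have : (⟨c, hc.1⟩ : N) ∈ LinearMap.ker ((rightHit f.ofConv).domRestrict N) :=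
      rightHit_eq_zero_of_mem_socle hf hc.2
    rw [h, Submodule.mem_bot] at this
    exact congrArg Subtype.val this
  have := Submodule.one_le_finrank_iff.2 ker_ne_bot
  have := ((rightHit f.ofConv).domRestrict N).finrank_range_add_finrank_ker
  rw [LinearMap.range_domRestrict] at this
  omega

theorem le_coradicalFiltration_of_finrank_le {n : ℕ} {N : Submodule k C} [FiniteDimensional k N]
    (hN : IsRightCoideal N) (hn : Module.finrank k N ≤ n) :
    N ≤ (coradicalFiltration k C n).carrier := by
  induction n generalizing N with
  | zero => exact (Submodule.finrank_eq_zero.1 (Nat.le_zero.1 hn)).trans_le bot_le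
  | succ n ih =>
    rcases eq_or_ne N ⊥ with rfl | h0
    · exact bot_le
    intro c hc f hf
    rw [Ideal.IsTwoSided.pow_succ] at hf
    induction hf using Submodule.mul_induction_on' with
    | mem_mul_mem g hg h hh =>
      rw [mul_apply_eq_apply_rightHit]
      have hlt := finrank_map_rightHit_lt hN h0 hg
      exact ih (isRightCoideal_map_rightHit _ N hN) (by omega) ⟨c, hc, rfl⟩ h hh
    | add g _ h _ hg hh => exact (congrArg₂ (· + ·) hg hh).trans (add_zero 0)

theorem exists_mem_coradicalFiltration (c : C) :
    ∃ n, c ∈ (coradicalFiltration k C n).carrier := by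
  obtain ⟨N, hN, _, hc⟩ := exists_isRightCoideal_finiteDimensional_mem (k := k) c
  exact ⟨_, le_coradicalFiltration_of_finrank_le hN le_rfl hc⟩

end CoradicalFiltration

section Gluing

theorem exists_linearMap_eqOn_of_monotone {R V W : Type*} [Semiring R] [AddCommMonoid V]
    [Module R V] [AddCommMonoid W] [Module R W] {U : ℕ → Submodule R V} (hU : Monotone U)
    (exists_mem : ∀ v, ∃ n, v ∈ U n) (f : ℕ → V →ₗ[R] W)
    (hf : ∀ n, Set.EqOn (f (n + 1)) (f n) (U n)) :
    ∃ g : V →ₗ[R] W, ∀ n, Set.EqOn g (f n) (U n) := by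
  have eqOn_of_le {m n : ℕ} (h : m ≤ n) : Set.EqOn (f n) (f m) (U m) := by
    induction n, h using Nat.le_induction with
    | base => exact Set.eqOn_refl _ _
    | succ n h ih => exact ((hf n).mono (hU h)).trans ih
  choose deg mem_deg using exists_mem
  have eqOn_deg (n : ℕ) : Set.EqOn (fun v ↦ f (deg v) v) (f n) (U n) := fun v hv ↦
    (le_total n (deg v)).elim (fun h ↦ eqOn_of_le h hv) fun h ↦ (eqOn_of_le h (mem_deg v)).symm
  refine ⟨⟨⟨fun v ↦ f (deg v) v, fun v w ↦ ?_⟩, fun r v ↦ ?_⟩, eqOn_deg⟩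
  · have hv := hU (le_max_left (deg v) (deg w)) (mem_deg v)
    have hw := hU (le_max_right (deg v) (deg w)) (mem_deg w)
    exact (eqOn_deg _ (add_mem hv hw)).trans <| (map_add _ v w).trans <|
      congrArg₂ (· + ·) (eqOn_deg _ hv).symm (eqOn_deg _ hw).symm
  · exact (eqOn_deg _ (Submodule.smul_mem _ r (mem_deg v))).trans (map_smul _ r v)

end Gluing

section DualAlgebraFiltration

variable (k C : Type*) [Field k] [AddCommGroup C] [Module k C] [Coalgebra k C]

/-- The filtration of `C^*` by the annihilators of the terms of the coradical filtration. -/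
def dualFiltration (n : ℕ) : Ideal (DualAlgebra k C) :=
  RingHom.ker (coradicalFiltration k C n).restrict

variable {k C}

theorem mem_dualFiltration {n : ℕ} {f : DualAlgebra k C} :
    f ∈ dualFiltration k C n ↔ ∀ c ∈ (coradicalFiltration k C n).carrier, f c = 0 :=
  Subcoalgebra.mem_ker_restrict

theorem dualFiltration_one : dualFiltration k C 1 = dualRadical k C := by
  ext f
  rw [mem_dualFiltration, coradicalFiltration_one, mem_dualRadical]

theorem isCompleteFiltration_dualFiltration : IsCompleteFiltration (dualFiltration k C) where
  antitone m n h f hf :=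
    mem_dualFiltration.2 fun c hc ↦ mem_dualFiltration.1 hf c (coradicalFiltration_mono h hc)
  zero_eq_top := eq_top_iff.2 fun f _ ↦ mem_dualFiltration.2 fun c hc ↦ by
    rw [mem_coradicalFiltration_zero.1 hc, map_zero]
  mul_mem hf hg := mem_dualFiltration.2 fun _ ↦
    mul_apply_eq_zero_of_mem_coradicalFiltration (mem_dualFiltration.1 hf)
      (mem_dualFiltration.1 hg)
  eq_zero_of_forall_mem hf := WithConv.ext <| LinearMap.ext fun c ↦
    (exists_mem_coradicalFiltration (k := k) c).elim fun n ↦ mem_dualFiltration.1 (hf n) c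
  exists_limit f hf := by
    obtain ⟨g, hg⟩ := exists_linearMap_eqOn_of_monotone (coradicalFiltration_mono (k := k) (C := C))
      exists_mem_coradicalFiltration (fun n ↦ (f n).ofConv)
      fun n c hc ↦ sub_eq_zero.1 (mem_dualFiltration.1 (hf n) c hc)
    exact ⟨toConv g, fun n ↦ mem_dualFiltration.2 fun c hc ↦ sub_eq_zero.2 (hg n hc)⟩

end DualAlgebraFiltration

section Uniformizer

open DualAlgebra

variable {k C : Type*} [Field k] [AddCommGroup C] [Module k C] [Coalgebra k C]

theorem exists_commute_apply_ne_zero {D : Type*} [Ring D] [Algebra k D] [IsAzumaya k D]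
    (ψ : D →ₐ[k] DualAlgebra k C) {N : Submodule k C} (hN : IsRightCoideal N)
    (hNs : ¬ N ≤ socle k C) :
    ∃ x ∈ dualRadical k C, (∀ d, Commute (ψ d) x) ∧ ∃ c ∈ N, x c ≠ 0 := by
  by_contra! h
  refine hNs fun c hc ↦ mem_socle_of_forall_mem_dualRadical fun f hf ↦ ?_
  replace hf := le_inf_centralizer_mul_range ψ (I := (dualRadical k C).restrictScalars k)
    (fun d x hx ↦ (dualRadical k C).mul_mem_left (ψ d) hx)
    (fun d x hx ↦ (dualRadical k C).mul_mem_right (ψ d) hx) hf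
  induction hf using Submodule.mul_induction_on' with
  | mem_mul_mem x hx y hy =>
    rw [mul_apply_eq_apply_leftHit]
    exact h x hx.1 (fun d ↦ Subalgebra.mem_centralizer_iff k |>.1 hx.2 _ ⟨d, rfl⟩) _
      ((isRightCoideal_iff N).1 hN _ c hc)
  | add x _ y _ hx hy => exact (congrArg₂ (· + ·) hx hy).trans (add_zero 0)

theorem exists_minimal_not_le_socle (h : socle k C ≠ ⊤) :
    ∃ N : Submodule k C, IsRightCoideal N ∧ ¬ N ≤ socle k C ∧
      ∀ M : Submodule k C, IsRightCoideal M → M < N → M ≤ socle k C := by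
  obtain ⟨c, -, hc⟩ := SetLike.exists_of_lt h.lt_top
  obtain ⟨N₀, hN₀, _, hcN₀⟩ := exists_isRightCoideal_finiteDimensional_mem (k := k) c
  let S : Set (Submodule k C) :=
    {N | IsRightCoideal N ∧ FiniteDimensional k N ∧ ¬ N ≤ socle k C}
  have mem_S : N₀ ∈ S := ⟨hN₀, inferInstance, fun h ↦ hc (h hcN₀)⟩
  obtain ⟨N, ⟨hN, _, hNs⟩, hmin⟩ :=
    (measure fun N : Submodule k C ↦ Module.finrank k N).wf.has_min S ⟨N₀, mem_S⟩
  refine ⟨N, hN, hNs, fun M hM hMN ↦ ?_⟩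
  by_contra hMs
  exact hmin M ⟨hM, Submodule.finiteDimensional_of_le hMN.le, hMs⟩
    (Submodule.finrank_lt_finrank_of_lt hMN)

theorem IsChainCoalgebra.exists_commute_ker_rightHit_le_socle (hC : IsChainCoalgebra k C)
    {D : Type*} [Ring D] [Algebra k D] [IsAzumaya k D] (ψ : D →ₐ[k] DualAlgebra k C) :
    ∃ x ∈ dualRadical k C, (∀ d, Commute (ψ d) x) ∧
      LinearMap.ker (rightHit x.ofConv) ≤ socle k C := by
  by_cases htop : socle k C = ⊤
  · exact ⟨0, zero_mem _, fun d ↦ Commute.zero_right _, htop ▸ le_top⟩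
  obtain ⟨N, hN, hNs, hmin⟩ := exists_minimal_not_le_socle htop
  obtain ⟨x, hx, hcomm, c, hcN, hxc⟩ := exists_commute_apply_ne_zero ψ hN hNs
  have notMem_ker : c ∉ LinearMap.ker (rightHit x.ofConv) := fun h ↦ hxc <| by
    rw [← mul_one x, mul_apply_eq_apply_rightHit, LinearMap.mem_ker.1 h, map_zero]
  have hker := isRightCoideal_ker_rightHit x.ofConv
  have ker_le : LinearMap.ker (rightHit x.ofConv) ≤ N :=
    (hC _ _ hker hN).resolve_right fun h ↦ notMem_ker (h hcN)
  exact ⟨x, hx, hcomm, hmin _ hker (ker_le.lt_of_ne fun h ↦ notMem_ker (h ▸ hcN))⟩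

end Uniformizer

section FiniteDualEmbedding

open DualAlgebra

variable {k : Type*} [Field k]

namespace Subcoalgebra

variable {B C : Type*} [AddCommGroup B] [Module k B] [Coalgebra k B] [AddCommGroup C] [Module k C]
  [Coalgebra k C]

/-- The image of a coalgebra homomorphism, as a subcoalgebra. -/
def range (φ : B →ₗc[k] C) : Subcoalgebra k C where
  carrier := LinearMap.range φ.toLinearMap
  comul_mem := by
    rintro _ ⟨b, rfl⟩
    refine ⟨TensorProduct.map φ.toLinearMap.rangeRestrict φ.toLinearMap.rangeRestrict
      (Coalgebra.comul (R := k) b), ?_⟩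
    rw [← LinearMap.comp_apply, ← TensorProduct.map_comp]
    exact LinearMap.congr_fun φ.map_comp_comul b

/-- An injective coalgebra homomorphism is an isomorphism onto its image. -/
def equivRange (φ : B →ₗc[k] C) (hφ : Function.Injective φ) : B ≃ₗc[k] range φ :=
  { LinearEquiv.ofInjective φ.toLinearMap hφ with
    counit_comp := φ.counit_comp
    map_comp_comul := LinearMap.ext fun b ↦ (range φ).map_subtype_injective <| by
      let ε : B →ₗ[k] range φ := (LinearEquiv.ofInjective φ.toLinearMap hφ).toLinearMap
      have subtype_comp : (range φ).carrier.subtype ∘ₗ ε = φ.toLinearMap := rfl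
      change TensorProduct.map _ _ (TensorProduct.map ε ε (Coalgebra.comul (R := k) b)) =
        TensorProduct.map _ _ ((range φ).comul (ε b))
      rw [(range φ).map_comul, ← LinearMap.comp_apply, ← TensorProduct.map_comp, subtype_comp]
      exact LinearMap.congr_fun φ.map_comp_comul b }

end Subcoalgebra

variable {C : Type*} [AddCommGroup C] [Module k C] [Coalgebra k C]
  {B : Type*} [Ring B] [Algebra k B]

theorem finiteDimensional_quotient_ker {E : Type*} [Ring E] [Algebra k E] [FiniteDimensional k E]
    (Φ : B →ₐ[k] E) : FiniteDimensional k (B ⧸ RingHom.ker Φ) :=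
  FiniteDimensional.of_injective (Ideal.Quotient.liftₐ (RingHom.ker Φ) Φ fun _ h ↦ h).toLinearMap
    (RingHom.lift_injective_of_ker_le_ideal _ (fun _ h ↦ h) le_rfl)

theorem dualEval_comp_mem_finiteDualSubmodule (Φ : B →ₐ[k] DualAlgebra k C) (c : C) :
    Module.Dual.eval k C c ∘ₗ (WithConv.linearEquiv k (C →ₗ[k] k)).toLinearMap ∘ₗ Φ.toLinearMap ∈
      finiteDualSubmodule k B := by
  obtain ⟨N, hN, _, hc⟩ := exists_isRightCoideal_finiteDimensional_mem (k := k) c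
  refine ⟨RingHom.ker ((coidealAction hN).comp Φ), inferInstance,
    finiteDimensional_quotient_ker _, fun b hb ↦ ?_⟩
  have leftHit_eq_zero : leftHit (Φ b).ofConv c = 0 :=
    congrArg (fun g : Module.End k N ↦ (g ⟨c, hc⟩ : C)) hb
  change Φ b c = 0
  rw [← one_mul (Φ b), mul_apply_eq_apply_leftHit, leftHit_eq_zero, map_zero]

/-- The linear map `C → B°` whose value at `c` is `b ↦ Φ b c`. -/
def toFiniteDualLinearMap (Φ : B →ₐ[k] DualAlgebra k C) : C →ₗ[k] FiniteDual k B where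
  toFun c := ⟨_, dualEval_comp_mem_finiteDualSubmodule Φ c⟩
  map_add' c d := Subtype.ext <| LinearMap.ext fun b ↦ map_add (Φ b).ofConv c d
  map_smul' r c := Subtype.ext <| LinearMap.ext fun b ↦ map_smul (Φ b).ofConv r c

theorem incl_toFiniteDualLinearMap (Φ : B →ₐ[k] DualAlgebra k C) (c : C) (b : B) :
    FiniteDual.incl k B (toFiniteDualLinearMap Φ c) b = Φ b c :=
  rfl

theorem comul_toFiniteDualLinearMap (Φ : B →ₐ[k] DualAlgebra k C) (c : C) :
    TensorProduct.map (toFiniteDualLinearMap Φ) (toFiniteDualLinearMap Φ)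
      (Coalgebra.comul (R := k) c) = finiteDualComul (toFiniteDualLinearMap Φ c) := by
  refine finiteDualPairing_injective (TensorProduct.ext' fun a b ↦ ?_)
  rw [finiteDualPairing_comul, incl_toFiniteDualLinearMap, map_mul, LinearMap.convMul_apply]
  induction Coalgebra.comul (R := k) c with
  | zero => simp
  | tmul x y => simp [finiteDualPairing, incl_toFiniteDualLinearMap]
  | add s t hs ht => simp only [map_add, LinearMap.add_apply, hs, ht]

/-- The adjunction between the finite dual and the dual algebra: the coalgebra homomorphism
`C → B°` that corresponds to an algebra homomorphism `B → C^*`. -/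
def toFiniteDual (Φ : B →ₐ[k] DualAlgebra k C) : C →ₗc[k] FiniteDual k B :=
  { toFiniteDualLinearMap Φ with
    counit_comp := LinearMap.ext fun c ↦ by
      change Φ 1 c = Coalgebra.counit c
      rw [map_one, LinearMap.convOne_apply]
      rfl
    map_comp_comul := LinearMap.ext (comul_toFiniteDualLinearMap Φ) }

theorem toFiniteDual_injective {Φ : B →ₐ[k] DualAlgebra k C}
    (hΦ : ∀ c, (∀ b, Φ b c = 0) → c = 0) : Function.Injective (toFiniteDual Φ) :=
  (injective_iff_map_eq_zero _).2 fun c hc ↦ hΦ c fun b ↦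
    congrArg (fun f ↦ FiniteDual.incl k B f b) hc

theorem exists_subcoalgebra_finiteDual_equiv {Φ : B →ₐ[k] DualAlgebra k C}
    (hΦ : ∀ c, (∀ b, Φ b c = 0) → c = 0) :
    ∃ E : Subcoalgebra k (FiniteDual k B), Nonempty (C ≃ₗc[k] E) :=
  ⟨_, ⟨Subcoalgebra.equivRange _ (toFiniteDual_injective hΦ)⟩⟩

theorem eq_zero_of_forall_apply_eq_zero {Φ : B →ₐ[k] DualAlgebra k C}
    (hsurj : Function.Surjective ((coradical k C).restrict.comp Φ)) {b : B}
    (hb : Φ b ∈ dualRadical k C) (hker : LinearMap.ker (rightHit (Φ b).ofConv) ≤ socle k C)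
    {c : C} (hc : ∀ a, Φ a c = 0) : c = 0 := by
  obtain ⟨n, hn⟩ := exists_mem_coradicalFiltration (k := k) c
  induction n generalizing c with
  | zero => exact mem_coradicalFiltration_zero.1 hn
  | succ n ih =>
    have rightHit_eq_zero : rightHit (Φ b).ofConv c = 0 := by
      refine ih (fun a ↦ ?_) (rightHit_mem_coradicalFiltration (m := 1) ?_ (add_comm n 1 ▸ hn))
      · rw [← mul_apply_eq_apply_rightHit, ← map_mul, hc]
      · rwa [coradicalFiltration_one, ← mem_dualRadical]
    have mem_socle : c ∈ socle k C := hker rightHit_eq_zero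
    have : (⟨c, mem_socle⟩ : coradical k C) = 0 :=
      eq_of_forall_apply_eq (k := k) fun f ↦ by
        obtain ⟨a, rfl⟩ := hsurj f
        exact (hc a).trans (map_zero _).symm
    exact congrArg Subtype.val this

end FiniteDualEmbedding

end ChainCoalg

end

theorem mainTheorem9 {k : Type*} [Field k] {D : Type*} [DivisionRing D] [Algebra k D]
    [FiniteDimensional k D] [Algebra.IsCentral k D]
    {C : Type*} [AddCommGroup C] [Module k C] [Coalgebra k C]
    (hC : ChainCoalg.IsChainCoalgebraOfType k C D) :
    ∃ E : ChainCoalg.Subcoalgebra k (ChainCoalg.FiniteDual k (PowerSeries D)),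
      Nonempty (C ≃ₗc[k] E) := by
  open ChainCoalg in
  obtain ⟨hchain, ⟨e⟩⟩ := hC
  have : IsAzumaya k D := isAzumaya_of_isCentral_of_isSimpleRing
  obtain ⟨s, hs⟩ := exists_isSeparabilityIdempotent k D
  have hF : IsCompleteFiltration (dualFiltration k C) := isCompleteFiltration_dualFiltration
  obtain ⟨ψ, hψ⟩ := hF.exists_algHom_lift hs (coradical k C).restrict_surjective
    dualFiltration_one.symm e.toAlgHom
  obtain ⟨x, hx, hcomm, hker⟩ := hchain.exists_commute_ker_rightHit_le_socle ψ
  obtain ⟨Φ, hΦC, rfl⟩ := hF.exists_powerSeries_algHom ψ (by rwa [dualFiltration_one]) hcomm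
  refine exists_subcoalgebra_finiteDual_equiv fun c ↦
    eq_zero_of_forall_apply_eq_zero (fun f ↦ ?_) hx hker
  obtain ⟨d, rfl⟩ := e.surjective f
  refine ⟨PowerSeries.C d, Eq.trans ?_ (DFunLike.congr_fun hψ d)⟩
  exact congrArg (coradical k C).restrict (hΦC d)
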